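/- Let $(E,\|\cdot\|_E)$ be a real Banach space with continuous dual $E'$, and let $B_{E'}=\{f\in E' : \|f\|_{E'}\le 1\}$ be the closed unit ball of $E'$. Let $M\in\mathbb{N}$, $x_1,\dots,x_M\in E$, and let $(z_j)_{j=1}^M$ be, on a probability space with expectation $\mathbb{E}$, either a Rademacher family (independent random variables with values in $\{-1,1\}$, each value being taken with probability $1/2$) or an orthogaussian family (independent standard Gaussian real random variables). Set $C_z:=1$ in the Rademacher case and $C_z:=2$ in the orthogaussian case. Let $G\colon[0,\infty)\to[0,\infty)$ be convex and increasing (not necessarily strictly). Then the following inequalities hold in $[0,\infty]$. (i) For all integers $k_1,\dots,k_M\ge 1$, $$\mathbb{E}\, G\Bigl(\sup_{f\in B_{E'}}\Bigl|\sum_{j=1}^M z_j f(x_j)^{k_j}\Bigr|\Bigr)\le \mathbb{E}\, G\Bigl(2C_z\Bigl\|\sum_{j=1}^M z_j k_j\|x_j\|_E^{k_j-1}x_j\Bigr\|_E\Bigr).$$ (ii) For all real exponents $q_1,\dots,q_M\in[1,\infty)$, $$\mathbb{E}\, G\Bigl(\sup_{f\in B_{E'}}\Bigl|\sum_{j=1}^M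 z_j |f(x_j)|^{q_j}\Bigr|\Bigr)\le \mathbb{E}\, G\Bigl(2C_z\Bigl\|\sum_{j=1}^M z_j q_j\|x_j\|_E^{q_j-1}x_j\Bigr\|_E\Bigr).$$ Here $0^0:=1$. -/

import Mathlib

open MeasureTheory ProbabilityTheory

/-- A Rademacher family: independent random variables with values in `{-1, 1}`, each of the two
values being taken with probability `1 / 2`. -/
structure IsRademacherFamily {Ω ι : Type*} [MeasurableSpace Ω] (r : ι → Ω → ℝ) (P : Measure Ω) :
    Prop where
  measurable : ∀ j, Measurable (r j)
  values : ∀ j ω, r j ω = -1 ∨ r j ω = 1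
  prob_neg_one : ∀ j, P {ω | r j ω = -1} = 1 / 2
  prob_one : ∀ j, P {ω | r j ω = 1} = 1 / 2
  indep : iIndepFun r P

/-- An orthogaussian family: independent standard Gaussian real random variables. -/
structure IsOrthogaussianFamily {Ω ι : Type*} [MeasurableSpace Ω] (g : ι → Ω → ℝ) (P : Measure Ω) :
    Prop where
  measurable : ∀ j, Measurable (g j)
  law : ∀ j, P.map (g j) = gaussianReal 0 1
  indep : iIndepFun g P

/-! This is the Ledoux–Talagrand contraction principle, with the functionals in the dual ball as
index set. On `[-‖x j‖, ‖x j‖]` the maps `t ^ k` and `|t| ^ q` vanish at `0` and are Lipschitz with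
constant `a j`, the coefficient of `x j` on the right. For fixed weights, averaging over signs
allows one nonlinear coordinate at a time to be exchanged for its linear majorant
(`ConvexOn.add_iSup_le_add_iSup`); passing to absolute values costs the factor 2. The joint law of
`z` is invariant under sign changes, so the averaged inequality integrates. Nothing else about the
law enters, so the argument needs only `1 ≤ C`, also in the Gaussian case. -/

/-- Two-point form of Tomić's weak majorization inequality. -/
theorem ConvexOn.add_le_add_of_weakMajorization {G : ℝ → ℝ} (hc : ConvexOn ℝ (Set.Ici 0) G)
    (hm : MonotoneOn G (Set.Ici 0)) {a b A B : ℝ} (ha : 0 ≤ a) (hb : 0 ≤ b) (hA : 0 ≤ A)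
    (hB : 0 ≤ B) (hmax : max a b ≤ max A B) (hsum : a + b ≤ A + B) :
    G a + G b ≤ G A + G B := by
  wlog hAB : B ≤ A generalizing A B
  · have := this hB hA (by rwa [max_comm B A]) (by linarith) (le_of_not_ge hAB)
    linarith
  wlog hab : b ≤ a generalizing a b
  · have := this hb ha (by rwa [max_comm b a]) (by linarith) (le_of_not_ge hab)
    linarith
  rw [max_eq_left hab, max_eq_left hAB] at hmax
  rcases le_or_gt b B with hbB | hbB
  · exact add_le_add (hm ha hA hmax) (hm hb hB hbB)
  have hlt : 0 < A - B := by linarith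
  -- Raise `a` to `A + B - b`. Then `b` and `A + B - b` are convex combinations of `A` and `B` with
  -- swapped weights.
  have ha' : G a ≤ G (A + B - b) := hm ha (Set.mem_Ici.2 (by linarith)) (by linarith)
  have h0 : 0 ≤ (A - b) / (A - B) := div_nonneg (by linarith) hlt.le
  have h1 : 0 ≤ (b - B) / (A - B) := div_nonneg (by linarith) hlt.le
  have h01 : (A - b) / (A - B) + (b - B) / (A - B) = 1 := by field_simp; ring
  have e1 := hc.2 (Set.mem_Ici.2 hB) (Set.mem_Ici.2 hA) h0 h1 h01
  have e2 := hc.2 (Set.mem_Ici.2 hA) (Set.mem_Ici.2 hB) h0 h1 h01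
  simp only [smul_eq_mul] at e1 e2
  rw [show (A - b) / (A - B) * B + (b - B) / (A - B) * A = b by field_simp; ring] at e1
  rw [show (A - b) / (A - B) * A + (b - B) / (A - B) * B = A + B - b by field_simp; ring] at e2
  have e3 : G b + G (A + B - b) ≤ ((A - b) / (A - B) + (b - B) / (A - B)) * (G A + G B) := by
    linarith
  rw [h01] at e3
  linarith

/-- Replacing one coordinate of a symmetrized supremum by a dominating one. -/
theorem ConvexOn.add_iSup_le_add_iSup {I : Type*} {G : ℝ → ℝ} (hc : ConvexOn ℝ (Set.Ici 0) G)
    (hm : MonotoneOn G (Set.Ici 0)) (i₀ : I) {h u v : I → ℝ}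
    (hh : h i₀ = 0) (hu : u i₀ = 0) (hv : v i₀ = 0)
    (huv : ∀ i j, |u i - u j| ≤ |v i - v j|) {K : ℝ} (hhK : ∀ i, |h i| ≤ K)
    (hvK : ∀ i, |v i| ≤ K) :
    G (⨆ i, (h i + u i)) + G (⨆ i, (h i - u i)) ≤
      G (⨆ i, (h i + v i)) + G (⨆ i, (h i - v i)) := by
  have : Nonempty I := ⟨i₀⟩
  have huv0 : ∀ i, |u i| ≤ |v i| := fun i => by simpa [hu, hv] using huv i i₀
  -- Boundedness matters: a real `⨆` over an unbounded family is `0` by convention.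
  have bdd : ∀ f : I → ℝ, (∀ i, |f i| ≤ 2 * K) → BddAbove (Set.range f) := fun f hf =>
    ⟨2 * K, by rintro _ ⟨i, rfl⟩; exact (le_abs_self _).trans (hf i)⟩
  have b1 : BddAbove (Set.range fun i => h i + u i) := bdd _ fun i =>
    (abs_add_le _ _).trans (by linarith [hhK i, hvK i, huv0 i])
  have b2 : BddAbove (Set.range fun i => h i - u i) := bdd _ fun i =>
    (abs_sub _ _).trans (by linarith [hhK i, hvK i, huv0 i])
  have b3 : BddAbove (Set.range fun i => h i + v i) := bdd _ fun i =>
    (abs_add_le _ _).trans (by linarith [hhK i, hvK i])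
  have b4 : BddAbove (Set.range fun i => h i - v i) := bdd _ fun i =>
    (abs_sub _ _).trans (by linarith [hhK i, hvK i])
  have l3 := fun i => le_ciSup b3 i
  have l4 := fun i => le_ciSup b4 i
  have key : ∀ i, h i + |v i| ≤ max (⨆ i, (h i + v i)) (⨆ i, (h i - v i)) := fun i => by
    rcases abs_cases (v i) with ⟨e, -⟩ | ⟨e, -⟩
    · exact le_max_of_le_left (by rw [e]; exact l3 i)
    · exact le_max_of_le_right (by rw [e]; simpa [sub_eq_add_neg] using l4 i)
  refine hc.add_le_add_of_weakMajorization hm ?_ ?_ ?_ ?_ (max_le ?_ ?_) ?_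
  · simpa [hh, hu] using le_ciSup b1 i₀
  · simpa [hh, hu] using le_ciSup b2 i₀
  · simpa [hh, hv] using l3 i₀
  · simpa [hh, hv] using l4 i₀
  · exact ciSup_le fun i => le_trans (by linarith [le_abs_self (u i), huv0 i]) (key i)
  · exact ciSup_le fun i => le_trans (by linarith [neg_le_abs (u i), huv0 i]) (key i)
  -- For each pair `i`, `j`, bound `u i - u j` by `|v i - v j|`; its sign decides which index goes
  -- into which supremum on the right.
  · rw [← le_sub_iff_add_le]
    refine ciSup_le fun i => ?_
    rw [le_sub_comm]
    refine ciSup_le fun j => ?_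
    have := (le_abs_self _).trans (huv i j)
    rcases abs_cases (v i - v j) with ⟨e, -⟩ | ⟨e, -⟩
    · linarith [l3 i, l4 j]
    · linarith [l3 j, l4 i]

theorem abs_intUnit_cast_mul (e : ℤˣ) (t : ℝ) : |((e : ℤ) : ℝ) * t| = |t| := by
  rcases Int.units_eq_one_or e with rfl | rfl <;> simp

theorem abs_sum_intUnit_mul_le {ι I : Type*} {c : ι → I → ℝ} {K : ℝ} (hK : ∀ j i, |c j i| ≤ K)
    (s : Finset ι) (ε : ι → ℤˣ) (i : I) :
    |∑ j ∈ s, ((ε j : ℤ) : ℝ) * c j i| ≤ s.card * K := by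
  refine (Finset.abs_sum_le_sum_abs _ _).trans ?_
  rw [← nsmul_eq_mul]
  exact Finset.sum_le_card_nsmul _ _ _ fun j _ => by
    rw [abs_intUnit_cast_mul]; exact hK j i

/-! ### Contraction for averages over signs -/

section Comparison

variable {ι I : Type*} [Fintype ι] [DecidableEq ι] {G : ℝ → ℝ}

/-- One step of the Ledoux–Talagrand comparison: a single coordinate is replaced. -/
theorem sum_signs_iSup_update_le (hc : ConvexOn ℝ (Set.Ici 0) G)
    (hm : MonotoneOn G (Set.Ici 0)) (i₀ : I) {c : ι → I → ℝ} {v : I → ℝ} (l : ι)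
    (hc₀ : ∀ j, c j i₀ = 0) (hv₀ : v i₀ = 0)
    (hcv : ∀ i i', |c l i - c l i'| ≤ |v i - v i'|) {K : ℝ} (hcK : ∀ j i, |c j i| ≤ K)
    (hvK : ∀ i, |v i| ≤ K) :
    ∑ ε : ι → ℤˣ, G (⨆ i, ∑ j, ((ε j : ℤ) : ℝ) * c j i) ≤
      ∑ ε : ι → ℤˣ, G (⨆ i, ∑ j, ((ε j : ℤ) : ℝ) * Function.update c l v j i) := by
  have hK : 0 ≤ K := (abs_nonneg _).trans (hvK i₀)
  -- Pairing each `ε` with its flip at `l` isolates one coordinate with both signs.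
  have flip : ∀ Φ : (ι → ℤˣ) → ℝ,
      ∑ ε, Φ ε + ∑ ε, Φ ε = ∑ ε, (Φ ε + Φ (Function.update ε l (-ε l))) := fun Φ => by
    rw [Finset.sum_add_distrib]
    congr 1
    refine (Equiv.sum_comp (Function.Involutive.toPerm
      (fun ε : ι → ℤˣ => Function.update ε l (-ε l)) fun ε => ?_) Φ).symm
    simp
  have split : ∀ (ε : ι → ℤˣ) (d : ι → I → ℝ) (i : I), ∑ j, ((ε j : ℤ) : ℝ) * d j i =
      ∑ j ∈ Finset.univ.erase l, ((ε j : ℤ) : ℝ) * d j i + ((ε l : ℤ) : ℝ) * d l i :=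
    fun ε d i => (Finset.sum_erase_add _ _ (Finset.mem_univ l)).symm
  have upd : ∀ (ε : ι → ℤˣ) (d : ι → I → ℝ) (i : I),
      ∑ j ∈ Finset.univ.erase l, ((Function.update ε l (-ε l) j : ℤ) : ℝ) * d j i =
      ∑ j ∈ Finset.univ.erase l, ((ε j : ℤ) : ℝ) * d j i := fun ε d i =>
    Finset.sum_congr rfl fun j hj => by rw [Function.update_of_ne (Finset.ne_of_mem_erase hj)]
  have upd' : ∀ (ε : ι → ℤˣ) (i : I),
      ∑ j ∈ Finset.univ.erase l, ((ε j : ℤ) : ℝ) * Function.update c l v j i =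
      ∑ j ∈ Finset.univ.erase l, ((ε j : ℤ) : ℝ) * c j i := fun ε i =>
    Finset.sum_congr rfl fun j hj => by rw [Function.update_of_ne (Finset.ne_of_mem_erase hj)]
  suffices H : ∑ ε : ι → ℤˣ, G (⨆ i, ∑ j, ((ε j : ℤ) : ℝ) * c j i) +
      ∑ ε : ι → ℤˣ, G (⨆ i, ∑ j, ((ε j : ℤ) : ℝ) * c j i) ≤
      ∑ ε : ι → ℤˣ, G (⨆ i, ∑ j, ((ε j : ℤ) : ℝ) * Function.update c l v j i) +
      ∑ ε : ι → ℤˣ, G (⨆ i, ∑ j, ((ε j : ℤ) : ℝ) * Function.update c l v j i) by linarith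
  rw [flip, flip]
  refine Finset.sum_le_sum fun ε _ => ?_
  simp only [split, upd, upd', Function.update_self]
  have := hc.add_iSup_le_add_iSup hm i₀
    (h := fun i => ∑ j ∈ Finset.univ.erase l, ((ε j : ℤ) : ℝ) * c j i)
    (u := fun i => ((ε l : ℤ) : ℝ) * c l i) (v := fun i => ((ε l : ℤ) : ℝ) * v i)
    (K := ((Finset.univ.erase l).card : ℝ) * K + K)
    (by simp [hc₀]) (by simp [hc₀]) (by simp [hv₀])
    (fun i j => by simpa only [← mul_sub, abs_intUnit_cast_mul] using hcv i j)
    (fun i => (abs_sum_intUnit_mul_le hcK _ ε i).trans (by linarith))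
    (fun i => by
      rw [abs_intUnit_cast_mul]
      exact (hvK i).trans (le_add_of_nonneg_left (by positivity)))
  simpa [sub_eq_add_neg] using this

/-- Ledoux–Talagrand comparison for suprema without absolute values. -/
theorem sum_signs_iSup_le (hc : ConvexOn ℝ (Set.Ici 0) G) (hm : MonotoneOn G (Set.Ici 0))
    (i₀ : I) {u v : ι → I → ℝ} (hu₀ : ∀ j, u j i₀ = 0) (hv₀ : ∀ j, v j i₀ = 0)
    (huv : ∀ j i i', |u j i - u j i'| ≤ |v j i - v j i'|) {K : ℝ} (hvK : ∀ j i, |v j i| ≤ K) :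
    ∑ ε : ι → ℤˣ, G (⨆ i, ∑ j, ((ε j : ℤ) : ℝ) * u j i) ≤
      ∑ ε : ι → ℤˣ, G (⨆ i, ∑ j, ((ε j : ℤ) : ℝ) * v j i) := by
  have huK : ∀ j i, |u j i| ≤ K := fun j i =>
    le_trans (by simpa [hu₀, hv₀] using huv j i i₀) (hvK j i)
  suffices H : ∀ s : Finset ι, ∑ ε : ι → ℤˣ, G (⨆ i, ∑ j, ((ε j : ℤ) : ℝ) * u j i) ≤
      ∑ ε : ι → ℤˣ, G (⨆ i, ∑ j, ((ε j : ℤ) : ℝ) * s.piecewise v u j i) by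
    simpa using H Finset.univ
  intro s
  induction s using Finset.induction_on with
  | empty => simp
  | insert l s hl ih =>
    refine ih.trans ?_
    rw [Finset.piecewise_insert]
    refine sum_signs_iSup_update_le hc hm i₀ l (fun j => ?_) (hv₀ l) (fun i i' => ?_)
      (K := K) (fun j i => ?_) (hvK l)
    · by_cases hj : j ∈ s <;> simp [hj, hu₀, hv₀]
    · simpa [hl] using huv l i i'
    · by_cases hj : j ∈ s <;> simp [hj, huK, hvK]

/-- Ledoux–Talagrand comparison for suprema of absolute values. -/
theorem sum_signs_iSup_abs_le (hc : ConvexOn ℝ (Set.Ici 0) G) (hm : MonotoneOn G (Set.Ici 0))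
    (i₀ : I) {u v : ι → I → ℝ} (hu₀ : ∀ j, u j i₀ = 0) (hv₀ : ∀ j, v j i₀ = 0)
    (huv : ∀ j i i', |u j i - u j i'| ≤ |v j i - v j i'|) {K : ℝ} (hvK : ∀ j i, |v j i| ≤ K) :
    ∑ ε : ι → ℤˣ, G (⨆ i, |∑ j, ((ε j : ℤ) : ℝ) * u j i|) ≤
      ∑ ε : ι → ℤˣ, G (2 * ⨆ i, ∑ j, ((ε j : ℤ) : ℝ) * v j i) := by
  have : Nonempty I := ⟨i₀⟩
  have huK : ∀ j i, |u j i| ≤ K := fun j i =>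
    le_trans (by simpa [hu₀, hv₀] using huv j i i₀) (hvK j i)
  have hc2 : ConvexOn ℝ (Set.Ici 0) fun t => G (2 * t) := by
    refine ⟨convex_Ici 0, fun s hs t ht a b ha hb hab => ?_⟩
    have := hc.2 (x := 2 * s) (y := 2 * t) (by simpa using hs) (by simpa using ht) ha hb hab
    simp only [smul_eq_mul] at this ⊢
    rwa [show 2 * (a * s + b * t) = a * (2 * s) + b * (2 * t) by ring]
  have hm2 : MonotoneOn (fun t => G (2 * t)) (Set.Ici 0) := fun s hs t ht hst =>
    hm (by simpa using hs) (by simpa using ht) (by linarith)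
  refine le_trans ?_ (sum_signs_iSup_le hc2 hm2 i₀ hu₀ hv₀ huv hvK)
  set A : (ι → ℤˣ) → ℝ := fun ε => ⨆ i, ∑ j, ((ε j : ℤ) : ℝ) * u j i
  have lA : ∀ ε i, ∑ j, ((ε j : ℤ) : ℝ) * u j i ≤ A ε := fun ε i =>
    le_ciSup (f := fun i => ∑ j, ((ε j : ℤ) : ℝ) * u j i) ⟨(Finset.univ : Finset ι).card * K, by
      rintro _ ⟨i, rfl⟩
      exact (le_abs_self _).trans (abs_sum_intUnit_mul_le huK _ ε i)⟩ i
  have lA' : ∀ ε i, -∑ j, ((ε j : ℤ) : ℝ) * u j i ≤ A (-ε) := fun ε i => by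
    simpa using lA (-ε) i
  have A0 : ∀ ε, 0 ≤ A ε := fun ε => by simpa [hu₀] using lA ε i₀
  calc ∑ ε : ι → ℤˣ, G (⨆ i, |∑ j, ((ε j : ℤ) : ℝ) * u j i|)
      ≤ ∑ ε, ((1 / 2) * G (2 * A ε) + (1 / 2) * G (2 * A (-ε))) := by
        refine Finset.sum_le_sum fun ε _ => ?_
        -- Both terms are nonnegative because everything vanishes at `i₀`; midpoint convexity then
        -- produces the factor 2.
        have h1 : (⨆ i, |∑ j, ((ε j : ℤ) : ℝ) * u j i|) ≤ A ε + A (-ε) := ciSup_le fun i =>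
          abs_le'.2 ⟨by linarith [lA ε i, A0 (-ε)], by linarith [lA' ε i, A0 ε]⟩
        have h2 := hc2.2 (Set.mem_Ici.2 (A0 ε)) (Set.mem_Ici.2 (A0 (-ε)))
          (by norm_num : (0 : ℝ) ≤ 1 / 2) (by norm_num : (0 : ℝ) ≤ 1 / 2) (by norm_num)
        simp only [smul_eq_mul] at h2
        rw [show 2 * (1 / 2 * A ε + 1 / 2 * A (-ε)) = A ε + A (-ε) by ring] at h2
        exact (hm (Set.mem_Ici.2 (Real.iSup_nonneg fun i => abs_nonneg _))
          (Set.mem_Ici.2 (add_nonneg (A0 ε) (A0 (-ε)))) h1).trans h2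
    _ = ∑ ε, G (2 * A ε) := by
        have hneg : ∑ ε, G (2 * A (-ε)) = ∑ ε, G (2 * A ε) :=
          Equiv.sum_comp (Equiv.neg (ι → ℤˣ)) fun ε => G (2 * A ε)
        rw [Finset.sum_add_distrib, ← Finset.mul_sum, ← Finset.mul_sum, hneg]
        ring

end Comparison

/-! ### From sign averages to expectations -/

section Symmetry

variable {Ω ι : Type*} [MeasurableSpace Ω] {P : Measure Ω}

/-- The joint law of independent symmetric random variables is invariant under sign changes. -/
theorem map_signs_mul_eq_of_iIndepFun [Fintype ι] [IsProbabilityMeasure P] {z : ι → Ω → ℝ}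
    (hz : ∀ j, Measurable (z j)) (hind : iIndepFun z P)
    (hsymm : ∀ j, P.map (fun ω => -z j ω) = P.map (z j)) (ε : ι → ℤˣ) :
    P.map (fun ω j => ((ε j : ℤ) : ℝ) * z j ω) = P.map (fun ω j => z j ω) := by
  have hm : ∀ j, Measurable fun ω => ((ε j : ℤ) : ℝ) * z j ω := fun j => (hz j).const_mul _
  have hind' : iIndepFun (fun j ω => ((ε j : ℤ) : ℝ) * z j ω) P :=
    hind.comp (fun j t => ((ε j : ℤ) : ℝ) * t) fun j => measurable_const_mul _
  rw [(iIndepFun_iff_map_fun_eq_pi_map fun j => (hm j).aemeasurable).1 hind',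
    (iIndepFun_iff_map_fun_eq_pi_map fun j => (hz j).aemeasurable).1 hind]
  congr 1
  funext j
  rcases Int.units_eq_one_or (ε j) with e | e
  · simp [e]
  · simpa [e] using hsymm j

/-- An inequality between averages over all sign changes integrates to an inequality between
expectations of a sign-invariant random vector. -/
theorem lintegral_le_of_sum_signs_le [Fintype ι] [DecidableEq ι] {z : ι → Ω → ℝ} (hz : ∀ j, Measurable (z j))
    (hlaw : ∀ ε : ι → ℤˣ,
      P.map (fun ω j => ((ε j : ℤ) : ℝ) * z j ω) = P.map (fun ω j => z j ω))
    {F₁ F₂ : (ι → ℝ) → ENNReal} (h₁ : Measurable F₁) (h₂ : Measurable F₂)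
    (hF : ∀ w : ι → ℝ, ∑ ε : ι → ℤˣ, F₁ (fun j => ((ε j : ℤ) : ℝ) * w j) ≤
      ∑ ε : ι → ℤˣ, F₂ (fun j => ((ε j : ℤ) : ℝ) * w j)) :
    ∫⁻ ω, F₁ (fun j => z j ω) ∂P ≤ ∫⁻ ω, F₂ (fun j => z j ω) ∂P := by
  have hm : ∀ ε : ι → ℤˣ, Measurable fun ω j => ((ε j : ℤ) : ℝ) * z j ω := fun ε =>
    measurable_pi_lambda _ fun j => (hz j).const_mul _
  have inv : ∀ F : (ι → ℝ) → ENNReal, Measurable F → ∀ ε : ι → ℤˣ,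
      ∫⁻ ω, F (fun j => ((ε j : ℤ) : ℝ) * z j ω) ∂P = ∫⁻ ω, F (fun j => z j ω) ∂P :=
    fun F hF ε => by
      rw [← lintegral_map hF (hm ε), hlaw ε, lintegral_map hF (measurable_pi_lambda _ hz)]
  have avg : ∀ F : (ι → ℝ) → ENNReal, Measurable F →
      ∫⁻ ω, ∑ ε : ι → ℤˣ, F (fun j => ((ε j : ℤ) : ℝ) * z j ω) ∂P =
        Fintype.card (ι → ℤˣ) * ∫⁻ ω, F (fun j => z j ω) ∂P := fun F hF => by
    have hFm : ∀ ε ∈ (Finset.univ : Finset (ι → ℤˣ)),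
        Measurable fun ω => F (fun j => ((ε j : ℤ) : ℝ) * z j ω) := fun ε _ => hF.comp (hm ε)
    rw [lintegral_finsetSum _ hFm]
    simp [inv F hF]
  have H := lintegral_mono (μ := P) fun ω => hF fun j => z j ω
  rw [avg F₁ h₁, avg F₂ h₂] at H
  exact (ENNReal.mul_le_mul_iff_right (by simp)
    (ENNReal.natCast_ne_top _)).1 H

theorem IsRademacherFamily.map_neg [IsProbabilityMeasure P] {z : ι → Ω → ℝ}
    (h : IsRademacherFamily z P) (j : ι) : P.map (fun ω => -z j ω) = P.map (z j) := by
  ext s hs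
  rw [Measure.map_apply (f := fun ω => -z j ω) (h.measurable j).neg hs, Measure.map_apply (h.measurable j) hs]
  have key : ∀ (f : ℝ → ℝ), (fun ω => f (z j ω)) ⁻¹' s =
      {ω | z j ω = -1 ∧ f (-1) ∈ s} ∪ {ω | z j ω = 1 ∧ f 1 ∈ s} := fun f => by
    ext ω
    rcases h.values j ω with e | e <;> simp [e] <;> norm_num
  have k1 := key fun t => -t
  have k2 := key fun t => t
  have p1 := h.prob_neg_one j
  have p2 := h.prob_one j
  rw [k1, show z j ⁻¹' s = _ from k2]
  by_cases a : (-1 : ℝ) ∈ s <;> by_cases b : (1 : ℝ) ∈ s <;> simp [a, b, p1, p2]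

theorem IsOrthogaussianFamily.map_neg {z : ι → Ω → ℝ}
    (h : IsOrthogaussianFamily z P) (j : ι) : P.map (fun ω => -z j ω) = P.map (z j) := by
  have : P.map (fun ω => -z j ω) = (P.map (z j)).map fun t => -t := by
    rw [Measure.map_map measurable_neg (h.measurable j)]; rfl
  rw [this, h.law, gaussianReal_map_neg, neg_zero]

end Symmetry

/-- Mean value inequality on `[0, R]`; `1 ≤ q` gives differentiability at `0` and a derivative
bounded by its value at `R`. -/
theorem abs_rpow_sub_rpow_le {q R s t : ℝ} (hq : 1 ≤ q) (hs : 0 ≤ s) (ht : 0 ≤ t) (hsR : s ≤ R)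
    (htR : t ≤ R) : |s ^ q - t ^ q| ≤ q * R ^ (q - 1) * |s - t| := by
  refine (convex_Icc 0 R).norm_image_sub_le_of_norm_hasDerivWithin_le (f := fun y => y ^ q)
    (f' := fun y => q * y ^ (q - 1))
    (fun y _ => (Real.hasDerivAt_rpow_const (Or.inr hq)).hasDerivWithinAt) (fun y hy => ?_)
    ⟨ht, htR⟩ ⟨hs, hsR⟩
  have h0 : 0 ≤ y ^ (q - 1) := Real.rpow_nonneg hy.1 _
  rw [Real.norm_of_nonneg (by positivity)]
  exact mul_le_mul_of_nonneg_left (Real.rpow_le_rpow hy.1 hy.2 (by linarith)) (by linarith)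

/-- Comparison of `∑ j, z j * φ j (f (x j))` with `∑ j, z j * a j * f (x j)` over the dual unit
ball, where `φ j` is `a j`-Lipschitz on `[-‖x j‖, ‖x j‖]` and vanishes at `0`. -/
theorem lintegral_iSup_dual_ball_le {E Ω ι : Type*} [NormedAddCommGroup E] [NormedSpace ℝ E]
    [Fintype ι] [DecidableEq ι] [MeasurableSpace Ω] {P : Measure Ω} {x : ι → E} {z : ι → Ω → ℝ}
    (hz : ∀ j, Measurable (z j))
    (hlaw : ∀ ε : ι → ℤˣ,
      P.map (fun ω j => ((ε j : ℤ) : ℝ) * z j ω) = P.map (fun ω j => z j ω))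
    {G : ℝ → ℝ} (hG : ∀ t ∈ Set.Ici (0 : ℝ), 0 ≤ G t)
    (hc : ConvexOn ℝ (Set.Ici 0) G) (hm : MonotoneOn G (Set.Ici 0)) {C : ℝ} (hC : 1 ≤ C)
    {φ : ι → ℝ → ℝ} {a : ι → ℝ} (ha : ∀ j, 0 ≤ a j) (hφ₀ : ∀ j, φ j 0 = 0)
    (hφ : ∀ j s t, |s| ≤ ‖x j‖ → |t| ≤ ‖x j‖ → |φ j s - φ j t| ≤ a j * |s - t|) :
    ∫⁻ ω, ENNReal.ofReal (G (⨆ f : Metric.closedBall (0 : StrongDual ℝ E) 1,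
        |∑ j, z j ω * φ j ((f : StrongDual ℝ E) (x j))|)) ∂P
      ≤ ∫⁻ ω, ENNReal.ofReal (G (2 * C * ‖∑ j, (z j ω * a j) • x j‖)) ∂P := by
  have : Nonempty (Metric.closedBall (0 : StrongDual ℝ E) 1) := ⟨⟨0, by simp⟩⟩
  have hball : ∀ (f : Metric.closedBall (0 : StrongDual ℝ E) 1) (y : E),
      |(f : StrongDual ℝ E) y| ≤ ‖y‖ := fun f y => by
    have := (f : StrongDual ℝ E).le_of_opNorm_le (mem_closedBall_zero_iff.1 f.2) y
    simpa using this
  have hφb : ∀ j (f : Metric.closedBall (0 : StrongDual ℝ E) 1),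
      |φ j ((f : StrongDual ℝ E) (x j))| ≤ a j * ‖x j‖ := fun j f => by
    have := hφ j _ 0 (hball f (x j)) (by simp)
    rw [hφ₀, sub_zero, sub_zero] at this
    exact this.trans (mul_le_mul_of_nonneg_left (hball f (x j)) (ha j))
  -- `G` is controlled only on `[0, ∞)`; truncating makes it monotone on all of `ℝ`.
  have hGm : Measurable fun t => G (max t 0) := Monotone.measurable fun s t hst =>
    hm (by simp) (by simp) (max_le_max hst le_rfl)
  have comp_meas : ∀ N : (ι → ℝ) → ℝ, Measurable N → (∀ w, 0 ≤ N w) →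
      Measurable fun w => ENNReal.ofReal (G (N w)) := fun N hN h0 => by
    have := (hGm.comp hN).ennreal_ofReal
    simpa [Function.comp_def, h0] using this
  refine lintegral_le_of_sum_signs_le hz hlaw
    (F₁ := fun w => ENNReal.ofReal (G (⨆ f : Metric.closedBall (0 : StrongDual ℝ E) 1,
        |∑ j, w j * φ j ((f : StrongDual ℝ E) (x j))|)))
    (F₂ := fun w => ENNReal.ofReal (G (2 * C * ‖∑ j, (w j * a j) • x j‖))) ?_ ?_ fun w => ?_
  · refine comp_meas _ ?_ fun w => Real.iSup_nonneg fun f => abs_nonneg _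
    -- The ball may be uncountable, so measurability comes from lower semicontinuity of a supremum
    -- of continuous functions.
    refine (lowerSemicontinuous_ciSup (fun w => ⟨∑ j, |w j| * (a j * ‖x j‖), ?_⟩)
      fun f => Continuous.lowerSemicontinuous (by fun_prop)).measurable
    rintro _ ⟨f, rfl⟩
    refine (Finset.abs_sum_le_sum_abs _ _).trans (Finset.sum_le_sum fun j _ => ?_)
    rw [abs_mul]
    exact mul_le_mul_of_nonneg_left (hφb j f) (abs_nonneg _)
  · refine comp_meas _ (Continuous.measurable (by fun_prop)) fun w => ?_
    positivity
  · rw [← ENNReal.ofReal_sum_of_nonneg fun ε _ => hG _ (Real.iSup_nonneg fun f => abs_nonneg _),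
      ← ENNReal.ofReal_sum_of_nonneg fun ε _ => hG _ (Set.mem_Ici.2 (by positivity))]
    refine ENNReal.ofReal_le_ofReal ?_
    have key := sum_signs_iSup_abs_le (ι := ι) hc hm
      (⟨0, by simp⟩ : Metric.closedBall (0 : StrongDual ℝ E) 1)
      (u := fun j f => w j * φ j ((f : StrongDual ℝ E) (x j)))
      (v := fun j f => w j * (a j * (f : StrongDual ℝ E) (x j)))
      (K := ∑ j, |w j| * (a j * ‖x j‖))
      (fun j => by simp [hφ₀]) (fun j => by simp)
      (fun j f g => by
        rw [← mul_sub, ← mul_sub, ← mul_sub, abs_mul, abs_mul, abs_mul, abs_of_nonneg (ha j)]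
        exact mul_le_mul_of_nonneg_left (hφ j _ _ (hball f _) (hball g _)) (abs_nonneg _))
      (fun j f => by
        rw [abs_mul, abs_mul, abs_of_nonneg (ha j)]
        refine le_trans ?_ (Finset.single_le_sum (f := fun j => |w j| * (a j * ‖x j‖))
          (fun i _ => mul_nonneg (abs_nonneg _) (mul_nonneg (ha i) (norm_nonneg _)))
          (Finset.mem_univ j))
        exact mul_le_mul_of_nonneg_left (mul_le_mul_of_nonneg_left (hball f _) (ha j))
          (abs_nonneg _))
    simp only [← mul_assoc] at key ⊢
    refine key.trans (Finset.sum_le_sum fun ε _ => ?_)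
    have hle : ∀ f : Metric.closedBall (0 : StrongDual ℝ E) 1,
        ∑ j, ((ε j : ℤ) : ℝ) * w j * a j * (f : StrongDual ℝ E) (x j) ≤
          ‖∑ j, (((ε j : ℤ) : ℝ) * w j * a j) • x j‖ := fun f => by
      have := (le_abs_self _).trans (hball f (∑ j, (((ε j : ℤ) : ℝ) * w j * a j) • x j))
      simpa using this
    have h0 : 0 ≤ ⨆ f : Metric.closedBall (0 : StrongDual ℝ E) 1,
        ∑ j, ((ε j : ℤ) : ℝ) * w j * a j * (f : StrongDual ℝ E) (x j) := by
      refine le_trans (le_of_eq ?_) (le_ciSup ⟨_, Set.forall_mem_range.2 hle⟩ ⟨0, by simp⟩)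
      simp
    refine hm (Set.mem_Ici.2 (by positivity)) (Set.mem_Ici.2 (by positivity)) ?_
    have h1 := ciSup_le hle
    nlinarith [norm_nonneg (∑ j, (((ε j : ℤ) : ℝ) * w j * a j) • x j)]

theorem mainTheorem5
    {E : Type*} [NormedAddCommGroup E] [NormedSpace ℝ E]
    {Ω : Type*} [MeasurableSpace Ω] (P : Measure Ω) [IsProbabilityMeasure P]
    (M : ℕ) (x : Fin M → E) (z : Fin M → Ω → ℝ) (C : ℝ)
    (hz : (IsRademacherFamily z P ∧ C = 1) ∨ (IsOrthogaussianFamily z P ∧ C = 2))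
    (G : ℝ → ℝ) (hG_nonneg : ∀ t ∈ Set.Ici (0 : ℝ), 0 ≤ G t)
    (hG_convex : ConvexOn ℝ (Set.Ici (0 : ℝ)) G) (hG_mono : MonotoneOn G (Set.Ici (0 : ℝ))) :
    (∀ k : Fin M → ℕ, (∀ j, 1 ≤ k j) →
      ∫⁻ ω, ENNReal.ofReal (G (⨆ f : Metric.closedBall (0 : StrongDual ℝ E) 1,
          |∑ j, z j ω * (f : StrongDual ℝ E) (x j) ^ k j|)) ∂P
        ≤ ∫⁻ ω, ENNReal.ofReal (G (2 * C *
            ‖∑ j, (z j ω * (k j : ℝ) * ‖x j‖ ^ (k j - 1)) • x j‖)) ∂P) ∧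
    (∀ q : Fin M → ℝ, (∀ j, 1 ≤ q j) →
      ∫⁻ ω, ENNReal.ofReal (G (⨆ f : Metric.closedBall (0 : StrongDual ℝ E) 1,
          |∑ j, z j ω * |(f : StrongDual ℝ E) (x j)| ^ q j|)) ∂P
        ≤ ∫⁻ ω, ENNReal.ofReal (G (2 * C *
            ‖∑ j, (z j ω * q j * ‖x j‖ ^ (q j - 1)) • x j‖)) ∂P) := by
  obtain ⟨hmeas, hind, hsymm, hC⟩ : (∀ j, Measurable (z j)) ∧ iIndepFun z P ∧
      (∀ j, P.map (fun ω => -z j ω) = P.map (z j)) ∧ 1 ≤ C := by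
    rcases hz with ⟨h, rfl⟩ | ⟨h, rfl⟩
    · exact ⟨h.measurable, h.indep, h.map_neg, le_rfl⟩
    · exact ⟨h.measurable, h.indep, h.map_neg, one_le_two⟩
  have hlaw := map_signs_mul_eq_of_iIndepFun hmeas hind hsymm
  refine ⟨fun k hk => ?_, fun q hq => ?_⟩
  · simp only [mul_assoc (z _ _)]
    refine lintegral_iSup_dual_ball_le hmeas hlaw hG_nonneg hG_convex hG_mono hC
      (φ := fun j t => t ^ k j) (a := fun j => (k j : ℝ) * ‖x j‖ ^ (k j - 1))
      (fun j => by positivity) (fun j => zero_pow (by have := hk j; omega))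
      fun j s t hs ht => ?_
    refine (abs_pow_sub_pow_le s t (k j)).trans ?_
    rw [mul_assoc, mul_comm |s - t|]
    gcongr
    exact max_le hs ht
  · simp only [mul_assoc (z _ _)]
    refine lintegral_iSup_dual_ball_le hmeas hlaw hG_nonneg hG_convex hG_mono hC
      (φ := fun j t => |t| ^ q j) (a := fun j => q j * ‖x j‖ ^ (q j - 1))
      (fun j => mul_nonneg (by linarith [hq j]) (Real.rpow_nonneg (norm_nonneg _) _))
      (fun j => by
        rw [abs_zero, Real.zero_rpow (by linarith [hq j])])
      fun j s t hs ht => ?_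
    refine (abs_rpow_sub_rpow_le (hq j) (abs_nonneg s) (abs_nonneg t) hs ht).trans ?_
    exact mul_le_mul_of_nonneg_left (abs_abs_sub_abs_le s t)
      (mul_nonneg (by linarith [hq j]) (Real.rpow_nonneg (norm_nonneg _) _))
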